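/- Let $g\colon\mathbb R^n\to\mathbb R^m$ be smooth and let $q_0,q_N\in\mathbb R^n$. Call $(u,\lambda)\in C^\infty([0,1],\mathbb R^n\times\mathbb R^m)$ with associated state $q\in C^\infty([0,1],\mathbb R^n)$ admissible if $\dot q=u$ on $[0,1]$, $q(0)=q_0$ and $q(1)=q_N$. On admissible controls consider the cost $$J(u,\lambda)=\int_0^1\Bigl(\tfrac12\|u(t)\|^2-g(q(t))^\top\lambda(t)\Bigr)\,dt .$$ Let $(u,\lambda)$, with associated state $q$, be an admissible control that is optimal in the sense that it extremises $J$, i.e. it is a local (in particular, possibly global) minimiser or maximiser of $J$ among the admissible controls with respect to uniform distance of $(u,\lambda,q)$ on $[0,1]$, or, more generally, a stationary point of $J$: for all $v\in C^\infty([0,1],\mathbb R^n)$ with $v(0)=v(1)=0$ and all $w\in C^\infty([0,1],\mathbb R^m)$, $$\frac{d}{d\varepsilon}\Big|_{\varepsilon=0}J(u+\varepsilon\dot v,\lambda+\varepsilon w)=0,$$ where the control $(u+\varepsilon\dot v,\lambda+\varepsilon w)$ has associated state $q+\varepsilon v$. Then there is a costate trajectory $p\in C^\infty([0,1],\mathbb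 R^n)$ such that on $[0,1]$ $$\dot q=u,\qquad \dot p=-g'(q)^\top\lambda,$$ subject to the algebraic constraints $g(q)=0$ and $p=u$, and the boundary conditions $q(0)=q_0$, $q(1)=q_N$. -/

import Mathlib

open scoped ContDiff

noncomputable section

namespace GeodesicOCP

/-- Smooth controls `(u, lam)` on `[0,1]` together with the associated smooth state `q`:
`q' = u` on `[0,1]`, `q 0 = a`, `q 1 = b`.  (Only the values on `[0,1]` matter.) -/
structure IsAdmissible {n m : ℕ} (a b : EuclideanSpace ℝ (Fin n))
    (u : ℝ → EuclideanSpace ℝ (Fin n)) (lam : ℝ → EuclideanSpace ℝ (Fin m))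
    (q : ℝ → EuclideanSpace ℝ (Fin n)) : Prop where
  smooth_control : ContDiffOn ℝ ∞ u (Set.Icc 0 1)
  smooth_multiplier : ContDiffOn ℝ ∞ lam (Set.Icc 0 1)
  smooth_state : ContDiffOn ℝ ∞ q (Set.Icc 0 1)
  state_eq : ∀ t ∈ Set.Icc (0 : ℝ) 1, HasDerivWithinAt q (u t) (Set.Icc 0 1) t
  left : q 0 = a
  right : q 1 = b

/-- The cost `∫₀¹ (½‖u‖² - g(q)ᵀ lam) dt` of the controls `(u, lam)` with associated state `q`. -/
def cost {n m : ℕ} (g : EuclideanSpace ℝ (Fin n) → EuclideanSpace ℝ (Fin m))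
    (u : ℝ → EuclideanSpace ℝ (Fin n)) (lam : ℝ → EuclideanSpace ℝ (Fin m))
    (q : ℝ → EuclideanSpace ℝ (Fin n)) : ℝ :=
  ∫ t in (0 : ℝ)..1, ((1 / 2 : ℝ) * ‖u t‖ ^ 2 - inner ℝ (g (q t)) (lam t))

/-- The triples `(u', lam', q')` whose values are `δ`-close to `(u, lam, q)` on `[0,1]`. -/
def IsClose {n m : ℕ} (δ : ℝ)
    (u u' : ℝ → EuclideanSpace ℝ (Fin n)) (lam lam' : ℝ → EuclideanSpace ℝ (Fin m))
    (q q' : ℝ → EuclideanSpace ℝ (Fin n)) : Prop :=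
  ∀ t ∈ Set.Icc (0 : ℝ) 1, ‖u' t - u t‖ < δ ∧ ‖lam' t - lam t‖ < δ ∧ ‖q' t - q t‖ < δ

/-- (Weak) local minimisers of the cost among the admissible controls; every global minimiser
is one. -/
def IsLocalMinimiser {n m : ℕ} (g : EuclideanSpace ℝ (Fin n) → EuclideanSpace ℝ (Fin m))
    (a b : EuclideanSpace ℝ (Fin n))
    (u : ℝ → EuclideanSpace ℝ (Fin n)) (lam : ℝ → EuclideanSpace ℝ (Fin m))
    (q : ℝ → EuclideanSpace ℝ (Fin n)) : Prop :=
  ∃ δ > 0, ∀ u' lam' q', IsAdmissible a b u' lam' q' → IsClose δ u u' lam lam' q q' →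
    cost g u lam q ≤ cost g u' lam' q'

/-- (Weak) local maximisers of the cost among the admissible controls. -/
def IsLocalMaximiser {n m : ℕ} (g : EuclideanSpace ℝ (Fin n) → EuclideanSpace ℝ (Fin m))
    (a b : EuclideanSpace ℝ (Fin n))
    (u : ℝ → EuclideanSpace ℝ (Fin n)) (lam : ℝ → EuclideanSpace ℝ (Fin m))
    (q : ℝ → EuclideanSpace ℝ (Fin n)) : Prop :=
  ∃ δ > 0, ∀ u' lam' q', IsAdmissible a b u' lam' q' → IsClose δ u u' lam lam' q q' →
    cost g u' lam' q' ≤ cost g u lam q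

/-- The first variation of the cost vanishes: the directional derivative is zero along every
smooth variation `(η, w)` of the controls, with associated variation `v` of the state, that keeps
the endpoints fixed (`v' = η`, `v 0 = 0 = v 1`). -/
def IsStationary {n m : ℕ} (g : EuclideanSpace ℝ (Fin n) → EuclideanSpace ℝ (Fin m))
    (u : ℝ → EuclideanSpace ℝ (Fin n)) (lam : ℝ → EuclideanSpace ℝ (Fin m))
    (q : ℝ → EuclideanSpace ℝ (Fin n)) : Prop :=
  ∀ (η : ℝ → EuclideanSpace ℝ (Fin n)) (w : ℝ → EuclideanSpace ℝ (Fin m))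
    (v : ℝ → EuclideanSpace ℝ (Fin n)), IsAdmissible 0 0 η w v →
    HasDerivAt (fun ε : ℝ => cost g (u + ε • η) (lam + ε • w) (q + ε • v)) 0 0

/-- Optimal controls, in the sense of extremising the cost: admissible, and a local minimiser,
a local maximiser or a stationary point of the cost.  (The cost is affine in `lam`, so apart from
degenerate `g` its extremals are saddle points; the stationary case is the essential one.) -/
def IsOptimal {n m : ℕ} (g : EuclideanSpace ℝ (Fin n) → EuclideanSpace ℝ (Fin m))
    (a b : EuclideanSpace ℝ (Fin n))
    (u : ℝ → EuclideanSpace ℝ (Fin n)) (lam : ℝ → EuclideanSpace ℝ (Fin m))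
    (q : ℝ → EuclideanSpace ℝ (Fin n)) : Prop :=
  IsAdmissible a b u lam q ∧
    (IsLocalMinimiser g a b u lam q ∨ IsLocalMaximiser g a b u lam q ∨ IsStationary g u lam q)

end GeodesicOCP

end

/-!
Fermat's theorem turns a local extremiser of the cost into a stationary point. The first variation
of the cost along `(η, w, v)`, with `v' = η`, is
`∫₀¹ (⟪u, η⟫ - ⟪g(q), w⟫ - ⟪g'(q)ᵀ lam, v⟫)`.
Since `w` is free, `g(q) = 0`; and since `v` is free in the interior, `u` has the weak derivative
`-g'(q)ᵀ lam`, which by continuity is its classical one. Hence `p = u` is the costate.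
-/

open Set Filter Topology MeasureTheory

section CalculusOfVariations

variable {a b : ℝ}

theorem hasDerivAt_intervalIntegral_comp_add_smul {X Y : Type*} [NormedAddCommGroup X]
    [NormedSpace ℝ X] [NormedAddCommGroup Y] [NormedSpace ℝ Y] {L : X → Y} (hL : ContDiff ℝ 1 L)
    {x ξ : ℝ → X} (hx : ContinuousOn x (uIcc a b)) (hξ : ContinuousOn ξ (uIcc a b)) :
    HasDerivAt (fun ε : ℝ => ∫ t in a..b, L (x t + ε • ξ t))
      (∫ t in a..b, fderiv ℝ L (x t) (ξ t)) 0 := by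
  have hline (ε : ℝ) : ContinuousOn (fun t => x t + ε • ξ t) (uIcc a b) :=
    hx.add (hξ.const_smul ε)
  have hL_line (ε : ℝ) : ContinuousOn (fun t => L (x t + ε • ξ t)) (uIcc a b) :=
    hL.continuous.comp_continuousOn (hline ε)
  have hL' : Continuous (fderiv ℝ L) := hL.continuous_fderiv one_ne_zero
  have hderiv (ε t : ℝ) : HasDerivAt (fun ε : ℝ => L (x t + ε • ξ t))
      (fderiv ℝ L (x t + ε • ξ t) (ξ t)) ε := by
    have hsegment : HasDerivAt (fun ε : ℝ => x t + ε • ξ t) (ξ t) ε := by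
      simpa using ((hasDerivAt_id ε).smul_const (ξ t)).const_add (x t)
    exact (hL.differentiable one_ne_zero _).hasFDerivAt.comp_hasDerivAt ε hsegment
  have hderiv_cont : ContinuousOn
      (fun z : ℝ × ℝ => fderiv ℝ L (x z.2 + z.1 • ξ z.2) (ξ z.2))
      (Metric.closedBall 0 1 ×ˢ uIcc a b) := by
    have hx_snd := hx.comp continuousOn_snd (mapsTo_snd_prod (s := Metric.closedBall (0 : ℝ) 1))
    have hξ_snd := hξ.comp continuousOn_snd (mapsTo_snd_prod (s := Metric.closedBall (0 : ℝ) 1))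
    exact (hL'.comp_continuousOn (hx_snd.add (continuousOn_fst.smul hξ_snd))).clm_apply hξ_snd
  obtain ⟨C, hC⟩ := ((isCompact_closedBall (0 : ℝ) 1).prod
    isCompact_uIcc).exists_bound_of_continuousOn hderiv_cont
  have hleibniz := (intervalIntegral.hasDerivAt_integral_of_dominated_loc_of_deriv_le
    (F := fun ε t => L (x t + ε • ξ t)) (μ := volume) (bound := fun _ => C)
    (Metric.closedBall_mem_nhds 0 one_pos)
    (Eventually.of_forall fun ε =>
      (hL_line ε).intervalIntegrable.aestronglyMeasurable_restrict_uIoc)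
    (hL_line 0).intervalIntegrable
    ((hL'.comp_continuousOn
      (hline 0)).clm_apply hξ).intervalIntegrable.aestronglyMeasurable_restrict_uIoc
    (Eventually.of_forall fun t ht ε hε => hC (ε, t) ⟨hε, uIoc_subset_uIcc ht⟩)
    intervalIntegrable_const
    (Eventually.of_forall fun t _ ε _ => hderiv ε t)).2
  simpa only [zero_smul, add_zero] using hleibniz

variable {E : Type*} [NormedAddCommGroup E] [InnerProductSpace ℝ E]

theorem eqOn_zero_of_forall_integral_inner_eq_zero (hab : a < b) {f : ℝ → E}
    (hf : ContinuousOn f (Icc a b))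
    (h : ∀ φ : ℝ → E, ContDiff ℝ ∞ φ → tsupport φ ⊆ Ioo a b →
      ∫ t in a..b, inner ℝ (f t) (φ t) = 0) :
    EqOn f 0 (Icc a b) := by
  intro s hs
  -- Testing against multiples of the fixed vector `f s` reduces to the scalar case.
  have hfs : ContinuousOn (fun t => inner ℝ (f t) (f s)) (Icc a b) := hf.inner continuousOn_const
  have hae : ∀ᵐ t, t ∈ Ioo a b → inner ℝ (f t) (f s) = 0 := by
    refine isOpen_Ioo.ae_eq_zero_of_integral_contDiff_smul_eq_zero
      ((hfs.mono Ioo_subset_Icc_self).locallyIntegrableOn measurableSet_Ioo)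
      fun ψ hψ _ hψ_supp => ?_
    have hψ_test := h (fun t => ψ t • f s) (hψ.smul contDiff_const)
      ((tsupport_smul_subset_left ψ fun _ => f s).trans hψ_supp)
    simp only [inner_smul_right] at hψ_test
    rw [← hψ_test, intervalIntegral.integral_of_le hab.le, eq_comm]
    refine setIntegral_eq_integral_of_forall_compl_eq_zero fun t ht => ?_
    have htψ : ψ t = 0 := image_eq_zero_of_notMem_tsupport fun hmem =>
      ht (Ioo_subset_Ioc_self (hψ_supp hmem))
    rw [htψ, zero_mul]
  have heq : EqOn (fun t => inner ℝ (f t) (f s)) 0 (Icc a b) :=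
    Measure.eqOn_Icc_of_ae_eq volume hab.ne
      (by rwa [← restrict_Ioo_eq_restrict_Icc, EventuallyEq,
        ae_restrict_iff' measurableSet_Ioo]) hfs continuousOn_const
  exact inner_self_eq_zero.1 (heq hs)

theorem integral_inner_deriv_add_deriv_inner_eq_sub (hab : a ≤ b) {u v u' v' : ℝ → E}
    (hu : ∀ t ∈ Icc a b, HasDerivWithinAt u (u' t) (Icc a b) t)
    (hv : ∀ t ∈ Icc a b, HasDerivWithinAt v (v' t) (Icc a b) t)
    (hu' : ContinuousOn u' (Icc a b)) (hv' : ContinuousOn v' (Icc a b)) :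
    ∫ t in a..b, (inner ℝ (u t) (v' t) + inner ℝ (u' t) (v t)) =
      inner ℝ (u b) (v b) - inner ℝ (u a) (v a) := by
  have hu_cont : ContinuousOn u (Icc a b) := HasDerivWithinAt.continuousOn hu
  have hv_cont : ContinuousOn v (Icc a b) := HasDerivWithinAt.continuousOn hv
  refine intervalIntegral.integral_eq_sub_of_hasDerivAt_of_le hab (hu_cont.inner hv_cont)
    (fun t ht => ?_)
    (((hu_cont.inner (𝕜 := ℝ) hv').add (hu'.inner (𝕜 := ℝ) hv_cont)).intervalIntegrable_of_Icc hab)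
  have hmem : Icc a b ∈ 𝓝 t := Icc_mem_nhds ht.1 ht.2
  exact ((hu t (Ioo_subset_Icc_self ht)).hasDerivAt hmem).inner ℝ
    ((hv t (Ioo_subset_Icc_self ht)).hasDerivAt hmem)

theorem hasDerivWithinAt_neg_of_forall_integral_inner_deriv_sub_eq_zero (hab : a < b)
    {u A : ℝ → E} (hu : ContDiffOn ℝ 1 u (Icc a b)) (hA : ContinuousOn A (Icc a b))
    (h : ∀ φ : ℝ → E, ContDiff ℝ ∞ φ → tsupport φ ⊆ Ioo a b →
      ∫ t in a..b, (inner ℝ (u t) (deriv φ t) - inner ℝ (A t) (φ t)) = 0)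
    {t : ℝ} (ht : t ∈ Icc a b) : HasDerivWithinAt u (-A t) (Icc a b) t := by
  set u' := derivWithin u (Icc a b)
  have hu' : ContinuousOn u' (Icc a b) :=
    hu.continuousOn_derivWithin (uniqueDiffOn_Icc hab) le_rfl
  have hderiv : ∀ s ∈ Icc a b, HasDerivWithinAt u (u' s) (Icc a b) s := fun s hs =>
    (hu.differentiableOn one_ne_zero s hs).hasDerivWithinAt
  suffices EqOn (u' + A) 0 (Icc a b) by
    rw [← eq_neg_of_add_eq_zero_left (this ht)]
    exact hderiv t ht
  refine eqOn_zero_of_forall_integral_inner_eq_zero hab (hu'.add hA) fun φ hφ hφ_supp => ?_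
  have hφ' : ContinuousOn (deriv φ) (Icc a b) := (hφ.continuous_deriv (by simp)).continuousOn
  have hφ_cont : ContinuousOn φ (Icc a b) := hφ.continuous.continuousOn
  have hφa : φ a = 0 := image_eq_zero_of_notMem_tsupport fun hmem => (hφ_supp hmem).1.false
  have hφb : φ b = 0 := image_eq_zero_of_notMem_tsupport fun hmem => (hφ_supp hmem).2.false
  have hparts := integral_inner_deriv_add_deriv_inner_eq_sub hab.le hderiv
    (fun s _ => (hφ.differentiable (by simp) s).hasDerivAt.hasDerivWithinAt) hu' hφ'
  rw [hφa, hφb, inner_zero_right, inner_zero_right, sub_zero] at hparts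
  calc ∫ s in a..b, inner ℝ ((u' + A) s) (φ s)
      = ∫ s in a..b, ((inner ℝ (u s) (deriv φ s) + inner ℝ (u' s) (φ s)) -
          (inner ℝ (u s) (deriv φ s) - inner ℝ (A s) (φ s))) := by
        simp only [Pi.add_apply, inner_add_left, add_sub_sub_cancel, add_comm]
    _ = 0 := by
        rw [intervalIntegral.integral_sub
          (((hu.continuousOn.inner hφ').add (hu'.inner hφ_cont)).intervalIntegrable_of_Icc hab.le)
          (((hu.continuousOn.inner hφ').sub (hA.inner hφ_cont)).intervalIntegrable_of_Icc hab.le),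
          hparts, h φ hφ hφ_supp, sub_zero]

end CalculusOfVariations

theorem eventually_forall_norm_smul_lt {𝕜 X V : Type*} [NontriviallyNormedField 𝕜]
    [TopologicalSpace X] [SeminormedAddCommGroup V] [NormedSpace 𝕜 V] {s : Set X}
    (hs : IsCompact s) {f : X → V} (hf : ContinuousOn f s) {δ : ℝ} (hδ : 0 < δ) :
    ∀ᶠ c : 𝕜 in 𝓝 0, ∀ x ∈ s, ‖c • f x‖ < δ := by
  have habsorbs : Absorbs 𝕜 (Metric.ball (0 : V) δ) (f '' s) :=
    NormedSpace.isVonNBounded_of_isBounded 𝕜 (hs.image_of_continuousOn hf).isBounded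
      (Metric.ball_mem_nhds 0 hδ)
  filter_upwards [habsorbs.eventually_nhds_zero (Metric.mem_ball_self hδ)] with c hc x hx
  exact mem_ball_zero_iff.1 (hc (mem_image_of_mem f hx))

namespace GeodesicOCP

section Lagrangian

variable {E F : Type*} [NormedAddCommGroup E] [InnerProductSpace ℝ E] [NormedAddCommGroup F]
  [InnerProductSpace ℝ F] {g : E → F}

/-- The integrand `½‖u‖² - g(q)ᵀ lam` of the cost, as a function of the triple `(u, lam, q)`. -/
noncomputable def lagrangian (g : E → F) (z : E × F × E) : ℝ :=
  (1 / 2 : ℝ) * ‖z.1‖ ^ 2 - inner ℝ (g z.2.2) z.2.1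

theorem contDiff_lagrangian {k : WithTop ℕ∞} (hg : ContDiff ℝ k g) :
    ContDiff ℝ k (lagrangian g) :=
  (contDiff_const.mul (contDiff_fst.norm_sq ℝ)).sub
    ((hg.comp (contDiff_snd.comp contDiff_snd)).inner ℝ (contDiff_fst.comp contDiff_snd))

theorem fderiv_lagrangian_apply (z ζ : E × F × E) (hg : DifferentiableAt ℝ g z.2.2) :
    fderiv ℝ (lagrangian g) z ζ = inner ℝ z.1 ζ.1 - inner ℝ (g z.2.2) ζ.2.1 -
      inner ℝ (fderiv ℝ g z.2.2 ζ.2.2) z.2.1 := by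
  have hstate : HasFDerivAt (fun z : E × F × E => z.2.2) _ z :=
    ((ContinuousLinearMap.snd ℝ F E).comp (ContinuousLinearMap.snd ℝ E (F × E))).hasFDerivAt
  have hmult : HasFDerivAt (fun z : E × F × E => z.2.1) _ z :=
    ((ContinuousLinearMap.fst ℝ F E).comp (ContinuousLinearMap.snd ℝ E (F × E))).hasFDerivAt
  have hderiv : HasFDerivAt (lagrangian g) _ z :=
    (hasFDerivAt_fst.norm_sq.const_mul (1 / 2 : ℝ)).sub
      ((hg.hasFDerivAt.comp z hstate).inner ℝ hmult)
  calc fderiv ℝ (lagrangian g) z ζ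
      = 1 / 2 * (2 • inner ℝ z.1 ζ.1) -
          (inner ℝ (g z.2.2) ζ.2.1 + inner ℝ (fderiv ℝ g z.2.2 ζ.2.2) z.2.1) := by
        rw [hderiv.fderiv]; rfl
    _ = inner ℝ z.1 ζ.1 - inner ℝ (g z.2.2) ζ.2.1 - inner ℝ (fderiv ℝ g z.2.2 ζ.2.2) z.2.1 := by
        ring

end Lagrangian

variable {n m : ℕ} {g : EuclideanSpace ℝ (Fin n) → EuclideanSpace ℝ (Fin m)}
  {a b : EuclideanSpace ℝ (Fin n)} {u η q v : ℝ → EuclideanSpace ℝ (Fin n)}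
  {lam w : ℝ → EuclideanSpace ℝ (Fin m)}

/-- The first variation of the cost at `(u, lam, q)` in the direction `(η, w, v)`. The relation
`v' = η` is not imposed, and the derivative of `g` is moved onto `lam` as an adjoint. -/
noncomputable def firstVariation (g : EuclideanSpace ℝ (Fin n) → EuclideanSpace ℝ (Fin m))
    (u : ℝ → EuclideanSpace ℝ (Fin n)) (lam : ℝ → EuclideanSpace ℝ (Fin m))
    (q η : ℝ → EuclideanSpace ℝ (Fin n)) (w : ℝ → EuclideanSpace ℝ (Fin m))
    (v : ℝ → EuclideanSpace ℝ (Fin n)) : ℝ :=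
  ∫ t in (0 : ℝ)..1, (inner ℝ (u t) (η t) - inner ℝ (g (q t)) (w t) -
    inner ℝ (ContinuousLinearMap.adjoint (fderiv ℝ g (q t)) (lam t)) (v t))

theorem hasDerivAt_cost (hg : ContDiff ℝ 1 g) (hu : ContinuousOn u (Icc 0 1))
    (hlam : ContinuousOn lam (Icc 0 1)) (hq : ContinuousOn q (Icc 0 1))
    (hη : ContinuousOn η (Icc 0 1)) (hw : ContinuousOn w (Icc 0 1))
    (hv : ContinuousOn v (Icc 0 1)) :
    HasDerivAt (fun ε : ℝ => cost g (u + ε • η) (lam + ε • w) (q + ε • v))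
      (firstVariation g u lam q η w v) 0 := by
  rw [← uIcc_of_le zero_le_one] at hu hlam hq hη hw hv
  have hderiv := hasDerivAt_intervalIntegral_comp_add_smul (contDiff_lagrangian hg)
    (hu.prodMk (hlam.prodMk hq)) (hη.prodMk (hw.prodMk hv))
  simp only [fderiv_lagrangian_apply _ _ (hg.differentiable one_ne_zero _)] at hderiv
  simp only [firstVariation, ContinuousLinearMap.adjoint_inner_left,
    real_inner_comm (fderiv ℝ g _ _)]
  exact hderiv

namespace IsAdmissible

theorem add_smul (h : IsAdmissible a b u lam q) (hv : IsAdmissible 0 0 η w v)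
    (ε : ℝ) : IsAdmissible a b (u + ε • η) (lam + ε • w) (q + ε • v) where
  smooth_control := h.smooth_control.add (hv.smooth_control.const_smul ε)
  smooth_multiplier := h.smooth_multiplier.add (hv.smooth_multiplier.const_smul ε)
  smooth_state := h.smooth_state.add (hv.smooth_state.const_smul ε)
  state_eq t ht := (h.state_eq t ht).add ((hv.state_eq t ht).const_smul ε)
  left := by simp [h.left, hv.left]
  right := by simp [h.right, hv.right]

theorem of_contDiff (hv : ContDiff ℝ ∞ v) (hw : ContDiffOn ℝ ∞ w (Icc 0 1)) :
    IsAdmissible (v 0) (v 1) (deriv v) w v where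
  smooth_control := (contDiff_infty_iff_deriv.1 hv).2.contDiffOn
  smooth_multiplier := hw
  smooth_state := hv.contDiffOn
  state_eq t _ := (hv.differentiable (by simp) t).hasDerivAt.hasDerivWithinAt
  left := rfl
  right := rfl

end IsAdmissible

theorem eventually_isClose_add_smul (hη : ContinuousOn η (Icc 0 1))
    (hw : ContinuousOn w (Icc 0 1)) (hv : ContinuousOn v (Icc 0 1)) {δ : ℝ} (hδ : 0 < δ) :
    ∀ᶠ ε : ℝ in 𝓝 0, IsClose δ u (u + ε • η) lam (lam + ε • w) q (q + ε • v) := by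
  filter_upwards [eventually_forall_norm_smul_lt isCompact_Icc hη hδ,
    eventually_forall_norm_smul_lt isCompact_Icc hw hδ,
    eventually_forall_norm_smul_lt isCompact_Icc hv hδ] with ε hεη hεw hεv t ht
  simpa using ⟨hεη t ht, hεw t ht, hεv t ht⟩

theorem IsLocalMinimiser.isLocalMin_cost_add_smul (hmin : IsLocalMinimiser g a b u lam q)
    (h : IsAdmissible a b u lam q) (hv : IsAdmissible 0 0 η w v) :
    IsLocalMin (fun ε : ℝ => cost g (u + ε • η) (lam + ε • w) (q + ε • v)) 0 := by
  obtain ⟨δ, hδ, hle⟩ := hmin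
  filter_upwards [eventually_isClose_add_smul hv.smooth_control.continuousOn
    hv.smooth_multiplier.continuousOn hv.smooth_state.continuousOn hδ] with ε hε
  simpa only [zero_smul, add_zero] using hle _ _ _ (h.add_smul hv ε) hε

theorem IsLocalMaximiser.isLocalMax_cost_add_smul (hmax : IsLocalMaximiser g a b u lam q)
    (h : IsAdmissible a b u lam q) (hv : IsAdmissible 0 0 η w v) :
    IsLocalMax (fun ε : ℝ => cost g (u + ε • η) (lam + ε • w) (q + ε • v)) 0 := by
  obtain ⟨δ, hδ, hle⟩ := hmax
  filter_upwards [eventually_isClose_add_smul hv.smooth_control.continuousOn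
    hv.smooth_multiplier.continuousOn hv.smooth_state.continuousOn hδ] with ε hε
  simpa only [zero_smul, add_zero] using hle _ _ _ (h.add_smul hv ε) hε

theorem IsOptimal.firstVariation_eq_zero (hg : ContDiff ℝ 1 g) (hopt : IsOptimal g a b u lam q)
    (hv : IsAdmissible 0 0 η w v) : firstVariation g u lam q η w v = 0 := by
  obtain ⟨h, hextr⟩ := hopt
  have hderiv := hasDerivAt_cost hg h.smooth_control.continuousOn
    h.smooth_multiplier.continuousOn h.smooth_state.continuousOn hv.smooth_control.continuousOn
    hv.smooth_multiplier.continuousOn hv.smooth_state.continuousOn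
  rcases hextr with hmin | hmax | hstat
  · exact (hmin.isLocalMin_cost_add_smul h hv).hasDerivAt_eq_zero hderiv
  · exact (hmax.isLocalMax_cost_add_smul h hv).hasDerivAt_eq_zero hderiv
  · exact hderiv.unique (hstat η w v hv)

theorem IsOptimal.constraint_eqOn_zero (hg : ContDiff ℝ 1 g) (hopt : IsOptimal g a b u lam q) :
    EqOn (g ∘ q) 0 (Icc 0 1) := by
  refine eqOn_zero_of_forall_integral_inner_eq_zero zero_lt_one
    (hg.continuous.comp_continuousOn hopt.1.smooth_state.continuousOn) fun w hw _ => ?_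
  have hvar := hopt.firstVariation_eq_zero hg
    (IsAdmissible.of_contDiff (v := fun _ => 0) contDiff_const hw.contDiffOn)
  simpa only [firstVariation, Function.comp_apply, deriv_const, inner_zero_right, zero_sub,
    sub_zero, intervalIntegral.integral_neg, neg_eq_zero] using hvar

theorem IsOptimal.hasDerivWithinAt_control (hg : ContDiff ℝ 1 g) (hopt : IsOptimal g a b u lam q)
    {t : ℝ} (ht : t ∈ Icc (0 : ℝ) 1) :
    HasDerivWithinAt u (-(ContinuousLinearMap.adjoint (fderiv ℝ g (q t)) (lam t)))
      (Icc 0 1) t := by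
  have hforce : ContinuousOn
      (fun t => ContinuousLinearMap.adjoint (fderiv ℝ g (q t)) (lam t)) (Icc 0 1) :=
    (ContinuousLinearMap.adjoint.continuous.comp_continuousOn
      ((hg.continuous_fderiv one_ne_zero).comp_continuousOn
        hopt.1.smooth_state.continuousOn)).clm_apply hopt.1.smooth_multiplier.continuousOn
  refine hasDerivWithinAt_neg_of_forall_integral_inner_deriv_sub_eq_zero zero_lt_one
    (hopt.1.smooth_control.of_le (by simp)) hforce (fun v hv hv_supp => ?_) ht
  have hv_left : v 0 = 0 := image_eq_zero_of_notMem_tsupport fun hmem => (hv_supp hmem).1.false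
  have hv_right : v 1 = 0 := image_eq_zero_of_notMem_tsupport fun hmem => (hv_supp hmem).2.false
  have hadm := IsAdmissible.of_contDiff (w := fun _ => (0 : EuclideanSpace ℝ (Fin m))) hv
    contDiffOn_const
  rw [hv_left, hv_right] at hadm
  simpa only [firstVariation, inner_zero_right, sub_zero] using
    hopt.firstVariation_eq_zero hg hadm

end GeodesicOCP

theorem mainTheorem2_general {n m : ℕ}
    (g : EuclideanSpace ℝ (Fin n) → EuclideanSpace ℝ (Fin m)) (hg : ContDiff ℝ 1 g)
    (q₀ qN : EuclideanSpace ℝ (Fin n))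
    (u : ℝ → EuclideanSpace ℝ (Fin n)) (lam : ℝ → EuclideanSpace ℝ (Fin m))
    (q : ℝ → EuclideanSpace ℝ (Fin n))
    (hopt : GeodesicOCP.IsOptimal g q₀ qN u lam q) :
    ∃ p : ℝ → EuclideanSpace ℝ (Fin n),
      ContDiffOn ℝ ∞ p (Set.Icc 0 1) ∧
      (∀ t ∈ Set.Icc (0 : ℝ) 1,
        HasDerivWithinAt q (u t) (Set.Icc 0 1) t ∧
        HasDerivWithinAt p (-(ContinuousLinearMap.adjoint (fderiv ℝ g (q t)) (lam t)))
          (Set.Icc 0 1) t ∧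
        g (q t) = 0 ∧
        p t = u t) ∧
      q 0 = q₀ ∧ q 1 = qN := by
  refine ⟨u, hopt.1.smooth_control, fun t ht => ⟨hopt.1.state_eq t ht, ?_, ?_, rfl⟩,
    hopt.1.left, hopt.1.right⟩
  · exact hopt.hasDerivWithinAt_control hg ht
  · exact hopt.constraint_eqOn_zero hg ht

theorem mainTheorem2 {n m : ℕ}
    (g : EuclideanSpace ℝ (Fin n) → EuclideanSpace ℝ (Fin m)) (hg : ContDiff ℝ ∞ g)
    (q₀ qN : EuclideanSpace ℝ (Fin n))
    (u : ℝ → EuclideanSpace ℝ (Fin n)) (lam : ℝ → EuclideanSpace ℝ (Fin m))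
    (q : ℝ → EuclideanSpace ℝ (Fin n))
    (hopt : GeodesicOCP.IsOptimal g q₀ qN u lam q) :
    ∃ p : ℝ → EuclideanSpace ℝ (Fin n),
      ContDiffOn ℝ ∞ p (Set.Icc 0 1) ∧
      (∀ t ∈ Set.Icc (0 : ℝ) 1,
        HasDerivWithinAt q (u t) (Set.Icc 0 1) t ∧
        HasDerivWithinAt p (-(ContinuousLinearMap.adjoint (fderiv ℝ g (q t)) (lam t)))
          (Set.Icc 0 1) t ∧
        g (q t) = 0 ∧
        p t = u t) ∧
      q 0 = q₀ ∧ q 1 = qN := by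
  exact mainTheorem2_general g (hg.of_le (by simp)) q₀ qN u lam q hopt
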